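/- **Conventions.** An *algebra* is a nonempty set $L$ with a collection of finitary operations on $L$. A *congruence* of $L$ is an equivalence relation compatible with all operations; $\mathrm{Con}\,L$ is the lattice of congruences under inclusion, $\Theta_L(x,y)$ is the least congruence identifying $x$ with $y$, and $\mathrm{Con}_c L$ is the $(\vee,0)$-semilattice of finitely generated congruences, i.e. finite joins (in $\mathrm{Con}\,L$) of congruences $\Theta_L(x,y)$. A binary operation on $L$ is *congruence-compatible* if every congruence of $L$ is also a congruence for it. A $(\vee,0)$-homomorphism is a map between join-semilattices with least element preserving $\vee$ and $0$. A map $\mu\colon S\to T$ between join-semilattices is *weakly distributive* if for all $x\in S$ and $y_0,y_1\in T$ with $\mu(x)\le y_0\vee y_1$ there are $x_0,x_1\in S$ with $x\le x_0\vee x_1$, $\mu(x_0)\le y_0$ and $\mu(x_1)\le y_1$. **The semilattice $\mathcal G(\Omega)$.** For a set $\Omega$, let $\mathcal L(\Omega)$ be the $(\vee,0)$-semilattice defined by generators $1$, $a_0^\xi$, $a_1^\xi$ ($\xi\in\Omega$) and relations $a_0^\xi\vee a_1^\xi=1$ ($\xi\in\Omega$), where $1$ is the largest element. For a $(\vee,0)$-semilattice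 $S$, let $\mathcal C(S)=\{(u,v,w)\in S^3 : w\le u\vee v\}$, and let $\mathcal R(S)$ be the set of all finite subsets $x\subseteq\mathcal C(S)$ such that 1. $x$ contains exactly one triple of the form $(u,u,u)$; we write $\pi(x)=u$; 2. if $(u,v,w)\in x$ and $(v,u,w)\in x$, then $u=v=w$; 3. if $(u,v,w)\in x$ and $(u,v,w)\ne(\pi(x),\pi(x),\pi(x))$, then $u\nleq\pi(x)$, $v\nleq\pi(x)$ and $w\nleq\pi(x)$; partially ordered by letting $x\le y$ if and only if every $(u,v,w)\in x\setminus y$ satisfies $u\le\pi(y)$ or $w\le\pi(y)$. Then $\mathcal R(S)$ is a $(\vee,0)$-semilattice, and $s\mapsto\{(s,s,s)\}$ is a $(\vee,0)$-embedding of $S$ into $\mathcal R(S)$, along which $S$ is identified with a subsemilattice of $\mathcal R(S)$. Put $\mathcal R^0(S)=S$, $\mathcal R^{n+1}(S)=\mathcal R(\mathcal R^n(S))$, $\mathcal D(S)=\bigcup_{n<\omega}\mathcal R^n(S)$, and $\mathcal G(\Omega)=\mathcal D(\mathcal L(\Omega))$. The element $1$ of $\mathcal L(\Omega)$ is the largest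 element of $\mathcal G(\Omega)$. **Theorem 6.1.** Let $\Omega$ be a set with $|\Omega|\ge\aleph_{\omega+1}$, and let $L$ be an algebra. If $L$ carries a join-semilattice structure with a largest element whose join operation is congruence-compatible, then there is no weakly distributive $(\vee,0)$-homomorphism from $\mathrm{Con}_c L$ to $\mathcal G(\Omega)$ whose range contains $1$. -/

import Mathlib

universe u v w

/-! ### Algebras, congruences, and weakly distributive homomorphisms -/

/-- A collection of finitary operations on a set `L`. An algebra is a nonempty `L` with such a
collection. -/
structure Operations (L : Type v) : Type (max v (w + 1)) where
  Index : Type w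
  arity : Index → ℕ
  op : ∀ i : Index, (Fin (arity i) → L) → L

namespace Operations

variable {L : Type v}

/-- A congruence of the algebra `(L, A)`. -/
@[ext]
structure Congruence (A : Operations.{v, w} L) : Type v where
  rel : L → L → Prop
  equiv : Equivalence rel
  compat : ∀ (i : A.Index) (x y : Fin (A.arity i) → L),
    (∀ k, rel (x k) (y k)) → rel (A.op i x) (A.op i y)

variable (A : Operations.{v, w} L)

/-- Congruences are ordered by inclusion. -/
instance : PartialOrder A.Congruence where
  le c d := ∀ x y, c.rel x y → d.rel x y
  le_refl _ _ _ h := h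
  le_trans _ _ _ h h' x y hxy := h' x y (h x y hxy)
  le_antisymm _ _ h h' := Congruence.ext (funext fun x => funext fun y =>
    propext ⟨h x y, h' x y⟩)

/-- Infima of congruences are intersections. -/
instance : InfSet A.Congruence where
  sInf s :=
    { rel := fun x y => ∀ c ∈ s, c.rel x y
      equiv := ⟨fun x c _ => c.equiv.refl x, fun h c hc => c.equiv.symm (h c hc),
        fun h h' c hc => c.equiv.trans (h c hc) (h' c hc)⟩
      compat := fun i x y h c hc => c.compat i x y fun k => h k c hc }

/-- The lattice of all congruences of `L`. -/
instance : CompleteLattice A.Congruence :=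
  completeLatticeOfInf _ fun _ =>
    ⟨fun c hc _ _ h => h c hc, fun _ hd x y hxy _ hc => hd hc x y hxy⟩

/-- The least congruence that identifies `x` with `y`. -/
def principal (x y : L) : A.Congruence := sInf {c | c.rel x y}

/-- A congruence is finitely generated if it is a finite join of principal congruences. -/
def FinitelyGenerated (c : A.Congruence) : Prop :=
  ∃ s : Finset (L × L), c = s.sup fun p => A.principal p.1 p.2

theorem FinitelyGenerated.bot : A.FinitelyGenerated ⊥ := ⟨∅, by simp⟩

theorem FinitelyGenerated.sup {c d : A.Congruence} (hc : A.FinitelyGenerated c)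
    (hd : A.FinitelyGenerated d) : A.FinitelyGenerated (c ⊔ d) := by
  classical
  obtain ⟨s, rfl⟩ := hc
  obtain ⟨t, rfl⟩ := hd
  exact ⟨s ∪ t, Finset.sup_union.symm⟩

/-- The `(∨, 0)`-semilattice of finitely generated congruences of `L`, under inclusion; its joins
are those of the congruence lattice. -/
def Conc : Type v := {c : A.Congruence // A.FinitelyGenerated c}

instance : SemilatticeSup A.Conc :=
  Subtype.semilatticeSup fun _ _ hc hd => FinitelyGenerated.sup A hc hd

instance : OrderBot A.Conc := Subtype.orderBot (FinitelyGenerated.bot A)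

/-- A binary operation on `L` is congruence-compatible if every congruence of the algebra is a
congruence for it. -/
def CongruenceCompatible (f : L → L → L) : Prop :=
  ∀ (c : A.Congruence) (x x' y y' : L), c.rel x x' → c.rel y y' → c.rel (f x y) (f x' y')

end Operations

/-- A map `μ` between join-semilattices is weakly distributive if, whenever `μ x ≤ y₀ ∨ y₁`, there
are `x₀, x₁` with `x ≤ x₀ ∨ x₁` and `μ xᵢ ≤ yᵢ`. -/
def WeaklyDistributive {S : Type v} {T : Type u} [SemilatticeSup S] [SemilatticeSup T]
    (μ : S → T) : Prop :=
  ∀ (x : S) (y₀ y₁ : T), μ x ≤ y₀ ⊔ y₁ →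
    ∃ x₀ x₁ : S, x ≤ x₀ ⊔ x₁ ∧ μ x₀ ≤ y₀ ∧ μ x₁ ≤ y₁

/-! ### The free distributive extension -/

/-- The set `R(S)` of reduced finite subsets `carrier` of
`C(S) = {(u, v, w) ∈ S³ | w ≤ u ∨ v}`. The element `proj` is `π(carrier)`, the unique `u` such that
`(u, u, u)` belongs to the set. -/
@[ext]
structure Reduced (S : Type u) [SemilatticeSup S] : Type u where
  carrier : Finset (S × S × S)
  proj : S
  le_sup : ∀ u v w, (u, v, w) ∈ carrier → w ≤ u ⊔ v
  diag_mem_iff : ∀ u, (u, u, u) ∈ carrier ↔ u = proj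
  eq_of_mem_swap : ∀ u v w, (u, v, w) ∈ carrier → (v, u, w) ∈ carrier → u = v ∧ v = w
  not_le_proj : ∀ u v w, (u, v, w) ∈ carrier → (u, v, w) ≠ (proj, proj, proj) →
    ¬ u ≤ proj ∧ ¬ v ≤ proj ∧ ¬ w ≤ proj

namespace Reduced

variable {S : Type u} [SemilatticeSup S]

theorem proj_mem (x : Reduced S) : (x.proj, x.proj, x.proj) ∈ x.carrier :=
  (x.diag_mem_iff _).2 rfl

theorem ext_carrier {x y : Reduced S} (h : x.carrier = y.carrier) : x = y := by
  have hp : x.proj = y.proj := (y.diag_mem_iff _).1 (h ▸ x.proj_mem)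
  exact Reduced.ext h hp

/-- `x ≤ y` iff every `(u, v, w) ∈ x \ y` satisfies `u ≤ π(y)` or `w ≤ π(y)`. -/
instance : LE (Reduced S) where
  le x y := ∀ u v w, (u, v, w) ∈ x.carrier → (u, v, w) ∉ y.carrier → u ≤ y.proj ∨ w ≤ y.proj

theorem le_def {x y : Reduced S} : x ≤ y ↔ ∀ u v w, (u, v, w) ∈ x.carrier →
    (u, v, w) ∉ y.carrier → u ≤ y.proj ∨ w ≤ y.proj := Iff.rfl

theorem proj_mono {x y : Reduced S} (h : x ≤ y) : x.proj ≤ y.proj := by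
  by_cases hm : (x.proj, x.proj, x.proj) ∈ y.carrier
  · exact ((y.diag_mem_iff _).1 hm).le
  · exact (h _ _ _ x.proj_mem hm).elim id id

theorem carrier_subset {x y : Reduced S} (h : x ≤ y) (h' : y ≤ x) :
    x.carrier ⊆ y.carrier := by
  have hp : x.proj = y.proj := le_antisymm (proj_mono h) (proj_mono h')
  rintro ⟨u, v, w⟩ hx
  by_contra hy
  have hne : (u, v, w) ≠ (x.proj, x.proj, x.proj) := by
    intro he
    rw [he, hp] at hy
    exact hy y.proj_mem
  have h1 := x.not_le_proj u v w hx hne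
  rw [hp] at h1
  exact (h u v w hx hy).elim h1.1 h1.2.2

instance : PartialOrder (Reduced S) where
  le_refl x u v w h h' := absurd h h'
  le_trans x y z hxy hyz u v w hx hz := by
    by_cases hy : (u, v, w) ∈ y.carrier
    · exact hyz u v w hy hz
    · exact (hxy u v w hx hy).imp (fun h => h.trans (proj_mono hyz))
        (fun h => h.trans (proj_mono hyz))
  le_antisymm x y h h' :=
    ext_carrier (Finset.Subset.antisymm (carrier_subset h h') (carrier_subset h' h))

/-- The canonical embedding of `S`, sending `a` to `{(a, a, a)}`. -/
def single (a : S) : Reduced S where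
  carrier := {(a, a, a)}
  proj := a
  le_sup u v w h := by
    simp only [Finset.mem_singleton, Prod.mk.injEq] at h
    obtain ⟨rfl, rfl, rfl⟩ := h
    exact le_sup_left
  diag_mem_iff u := by simp
  eq_of_mem_swap u v w h _ := by
    simp only [Finset.mem_singleton, Prod.mk.injEq] at h
    obtain ⟨rfl, rfl, rfl⟩ := h
    exact ⟨rfl, rfl⟩
  not_le_proj u v w h h' := absurd (Finset.mem_singleton.1 h) h'

theorem single_le_iff {a : S} {y : Reduced S} : single a ≤ y ↔ a ≤ y.proj := by
  refine ⟨fun h => proj_mono h, fun h u v w hm _ => ?_⟩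
  simp only [single, Finset.mem_singleton, Prod.mk.injEq] at hm
  obtain ⟨rfl, rfl, rfl⟩ := hm
  exact Or.inl h

theorem le_single_iff {x : Reduced S} {a : S} :
    x ≤ single a ↔ ∀ u v w, (u, v, w) ∈ x.carrier → u ≤ a ∨ w ≤ a := by
  refine ⟨fun h u v w hm => ?_, fun h u v w hm _ => h u v w hm⟩
  by_cases ha : (u, v, w) ∈ (single a).carrier
  · simp only [single, Finset.mem_singleton, Prod.mk.injEq] at ha
    exact Or.inl ha.1.le
  · exact h u v w hm ha

instance [OrderBot S] : OrderBot (Reduced S) where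
  bot := single ⊥
  bot_le _ := single_le_iff.2 bot_le

instance [OrderTop S] : OrderTop (Reduced S) where
  top := single ⊤
  le_top _ := le_single_iff.2 fun _ _ _ _ => Or.inl le_top

section Sup

open scoped Classical in
/-- The triples `(a, b, c) ∈ x ∪ y` whose last entry lies below every `q ≥ π(x) ∨ π(y)` that is
closed under the two rules: `c ≤ q` if both `(a, b, c)` and `(b, a, c)` are in `x ∪ y`, and
`c ≤ q` if `(a, b, c)` is in `x ∪ y` and `b ≤ q`. -/
noncomputable def absorbed (x y : Reduced S) : Finset (S × S × S) :=
  (x.carrier ∪ y.carrier).filter fun t => ∀ q : S,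
    (∀ a b c, (a, b, c) ∈ x.carrier ∪ y.carrier →
      ((b, a, c) ∈ x.carrier ∪ y.carrier ∨ b ≤ q) → c ≤ q) → t.2.2 ≤ q

theorem absorbed_nonempty (x y : Reduced S) : (absorbed x y).Nonempty := by
  classical
  refine ⟨(x.proj, x.proj, x.proj), ?_⟩
  have hm : (x.proj, x.proj, x.proj) ∈ x.carrier ∪ y.carrier :=
    Finset.mem_union_left _ x.proj_mem
  exact Finset.mem_filter.2 ⟨hm, fun q hq => hq _ _ _ hm (Or.inl hm)⟩

/-- The projection of `x ∨ y`. -/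
noncomputable def supProj (x y : Reduced S) : S :=
  (absorbed x y).sup' (absorbed_nonempty x y) fun t => t.2.2

open scoped Classical in
theorem supProj_closed (x y : Reduced S) (a b c : S) (hm : (a, b, c) ∈ x.carrier ∪ y.carrier)
    (h : (b, a, c) ∈ x.carrier ∪ y.carrier ∨ b ≤ supProj x y) : c ≤ supProj x y := by
  refine Finset.le_sup' (f := fun t : S × S × S => t.2.2) (b := (a, b, c))
    (Finset.mem_filter.2 ⟨hm, fun q hq => hq a b c hm (h.imp id fun hb => hb.trans ?_)⟩)
  exact Finset.sup'_le _ _ fun t ht => (Finset.mem_filter.1 ht).2 q hq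

open scoped Classical in
theorem supProj_le (x y : Reduced S) (q : S)
    (hq : ∀ a b c, (a, b, c) ∈ x.carrier ∪ y.carrier →
      ((b, a, c) ∈ x.carrier ∪ y.carrier ∨ b ≤ q) → c ≤ q) : supProj x y ≤ q :=
  Finset.sup'_le _ _ fun _ ht => (Finset.mem_filter.1 ht).2 q hq

open scoped Classical in
/-- The join of `x` and `y` in `R(S)`. -/
noncomputable def supReduced (x y : Reduced S) : Reduced S where
  carrier := insert (supProj x y, supProj x y, supProj x y)
    ((x.carrier ∪ y.carrier).filter fun t =>
      ¬ t.1 ≤ supProj x y ∧ ¬ t.2.1 ≤ supProj x y ∧ ¬ t.2.2 ≤ supProj x y)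
  proj := supProj x y
  le_sup u v w h := by
    simp only [Finset.mem_insert, Finset.mem_filter, Finset.mem_union, Prod.mk.injEq] at h
    rcases h with ⟨rfl, rfl, rfl⟩ | ⟨h | h, _⟩
    · exact le_sup_left
    · exact x.le_sup u v w h
    · exact y.le_sup u v w h
  diag_mem_iff u := by
    refine ⟨fun h => ?_, fun h => by simp [h]⟩
    rcases Finset.mem_insert.1 h with h | h
    · exact congrArg Prod.fst h
    · have h' := Finset.mem_filter.1 h
      exact absurd (supProj_closed x y u u u h'.1 (Or.inl h'.1)) h'.2.1
  eq_of_mem_swap u v w h h' := by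
    rcases Finset.mem_insert.1 h with h | h
    · simp only [Prod.mk.injEq] at h
      obtain ⟨rfl, rfl, rfl⟩ := h
      exact ⟨rfl, rfl⟩
    rcases Finset.mem_insert.1 h' with h' | h'
    · simp only [Prod.mk.injEq] at h'
      obtain ⟨rfl, rfl, rfl⟩ := h'
      exact ⟨rfl, rfl⟩
    have h1 := Finset.mem_filter.1 h
    have h2 := Finset.mem_filter.1 h'
    exact absurd (supProj_closed x y u v w h1.1 (Or.inl h2.1)) h1.2.2.2
  not_le_proj u v w h hne := by
    rcases Finset.mem_insert.1 h with h | h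
    · exact absurd h hne
    · exact (Finset.mem_filter.1 h).2

theorem le_supReduced_of_subset (x y z : Reduced S)
    (hz : ∀ t ∈ z.carrier, t ∈ x.carrier ∨ t ∈ y.carrier) : z ≤ supReduced x y := by
  classical
  intro u v w hm hn
  have hF : (u, v, w) ∈ x.carrier ∪ y.carrier := Finset.mem_union.2 (hz _ hm)
  change u ≤ supProj x y ∨ w ≤ supProj x y
  by_contra hcon
  rw [not_or] at hcon
  refine hn (Finset.mem_insert_of_mem (Finset.mem_filter.2 ⟨hF, hcon.1, fun hv => ?_, hcon.2⟩))
  exact hcon.2 (supProj_closed x y u v w hF (Or.inr hv))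

theorem supReduced_le (x y z : Reduced S) (hx : x ≤ z) (hy : y ≤ z) : supReduced x y ≤ z := by
  classical
  have hF : ∀ u v w, (u, v, w) ∈ x.carrier ∪ y.carrier →
      (u, v, w) ∈ z.carrier ∨ (u ≤ z.proj ∨ w ≤ z.proj) := fun u v w h => by
    by_cases hz : (u, v, w) ∈ z.carrier
    · exact Or.inl hz
    · exact Or.inr ((Finset.mem_union.1 h).elim (fun h => hx u v w h hz)
        (fun h => hy u v w h hz))
  have hle : ∀ u v w, (u, v, w) ∈ x.carrier ∪ y.carrier → w ≤ u ⊔ v := fun u v w h =>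
    (Finset.mem_union.1 h).elim (x.le_sup u v w) (y.le_sup u v w)
  have key : ∀ a b c, (a, b, c) ∈ x.carrier ∪ y.carrier → b ≤ z.proj → c ≤ z.proj := by
    intro a b c h hb
    rcases hF a b c h with hz | ha | hc
    · by_cases hne : (a, b, c) = (z.proj, z.proj, z.proj)
      · simp only [Prod.mk.injEq] at hne
        exact hne.2.2.le
      · exact absurd hb (z.not_le_proj a b c hz hne).2.1
    · exact (hle a b c h).trans (sup_le ha hb)
    · exact hc
  have hp : supProj x y ≤ z.proj := by
    refine supProj_le x y _ fun a b c h h' => ?_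
    rcases h' with h' | hb
    · rcases hF b a c h' with hz' | hb | hc
      · rcases hF a b c h with hz | ha | hc
        · obtain ⟨rfl, rfl⟩ := z.eq_of_mem_swap a b c hz hz'
          exact ((z.diag_mem_iff _).1 hz).le
        · exact key b a c h' ha
        · exact hc
      · exact key a b c h hb
      · exact hc
    · exact key a b c h hb
  intro u v w hm hn
  rcases Finset.mem_insert.1 hm with h | h
  · simp only [Prod.mk.injEq] at h
    exact Or.inl (h.1 ▸ hp)
  · exact (hF u v w (Finset.mem_filter.1 h).1).resolve_left hn

end Sup

noncomputable instance : SemilatticeSup (Reduced S) where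
  sup := supReduced
  le_sup_left x y := le_supReduced_of_subset x y x fun _ h => Or.inl h
  le_sup_right x y := le_supReduced_of_subset x y y fun _ h => Or.inr h
  sup_le x y z := supReduced_le x y z

/-- The canonical embedding `S → R(S)` is a `(∨, 0)`-homomorphism. -/
def embed (S : Type u) [SemilatticeSup S] [OrderBot S] : SupBotHom S (Reduced S) where
  toFun := single
  map_sup' a b := by
    refine le_antisymm (single_le_iff.2 (sup_le (single_le_iff.1 le_sup_left)
      (single_le_iff.1 le_sup_right))) (sup_le ?_ ?_)
    · exact single_le_iff.2 le_sup_left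
    · exact single_le_iff.2 le_sup_right
  map_bot' := rfl

end Reduced

/-! ### The increasing union of the iterated extensions -/

namespace FreeDistrib

/-- `R⁰(S) = S` and `Rⁿ⁺¹(S) = R(Rⁿ(S))`. -/
noncomputable def tower (S : Type u) [SemilatticeSup S] [OrderBot S] : ℕ → SemilatSupCat.{u}
  | 0 => SemilatSupCat.of S
  | n + 1 => SemilatSupCat.of (Reduced (tower S n).X)

/-- The underlying `(∨, 0)`-semilattice of `Rⁿ(S)`. -/
abbrev Tower (S : Type u) [SemilatticeSup S] [OrderBot S] (n : ℕ) : Type u := (tower S n).X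

section

variable (S : Type u) [SemilatticeSup S] [OrderBot S]

noncomputable instance (n : ℕ) : SemilatticeSup (Tower S n) := (tower S n).isSemilatticeSup

noncomputable instance (n : ℕ) : OrderBot (Tower S n) := (tower S n).isOrderBot

/-- The canonical embedding of `Rⁿ(S)` into `Rⁿ⁺¹(S)`. -/
noncomputable def step (n : ℕ) : SupBotHom (Tower S n) (Tower S (n + 1)) :=
  Reduced.embed (Tower S n)

/-- The composite embedding of `Rᵐ(S)` into `Rⁿ(S)`, for `m ≤ n`. -/
noncomputable def trans (m n : ℕ) (h : m ≤ n) : SupBotHom (Tower S m) (Tower S n) :=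
  Nat.leRecOn (C := fun k => SupBotHom (Tower S m) (Tower S k)) h
    (fun {k} g => (step S k).comp g) (SupBotHom.id _)

theorem trans_self (m : ℕ) : trans S m m le_rfl = SupBotHom.id _ := Nat.leRecOn_self _

theorem trans_succ (m n : ℕ) (h : m ≤ n) :
    trans S m (n + 1) (h.trans n.le_succ) = (step S n).comp (trans S m n h) :=
  Nat.leRecOn_succ h _

instance : DirectedSystem (Tower S) (trans S · · ·) where
  map_self m x := by rw [trans_self]; rfl
  map_map k j i hij hjk x := by
    induction k, hjk using Nat.le_induction with
    | base => rw [trans_self]; rfl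
    | succ k hk ih =>
      rw [trans_succ S j k hk, trans_succ S i k (hij.trans hk), SupBotHom.comp_apply,
        SupBotHom.comp_apply, ih]

/-- `D(S)`, the union of the increasing chain `S ⊆ R(S) ⊆ R²(S) ⊆ ⋯`, realized as the direct limit
along the canonical embeddings. -/
def D : Type u := DirectLimit (Tower S) (trans S)

/-- The canonical map from `Rⁿ(S)` into the union. -/
noncomputable def incl (n : ℕ) (x : Tower S n) : D S := (⟦⟨n, x⟩⟧ : DirectLimit (Tower S) (trans S))

theorem incl_trans (m n : ℕ) (h : m ≤ n) (x : Tower S m) :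
    incl S n (trans S m n h x) = incl S m x :=
  DirectLimit.mk_apply (f := trans S) m n x h

/-- Joins in `D(S)` are computed in `Rⁿ(S)` for large `n`. -/
noncomputable def join : D S → D S → D S :=
  DirectLimit.map₂ (trans S) (trans S) (trans S) (fun _ x y => x ⊔ y)
    fun i j h x y => map_sup (trans S i j h) x y

theorem join_incl (n : ℕ) (x y : Tower S n) :
    join S (incl S n x) (incl S n y) = incl S n (x ⊔ y) :=
  DirectLimit.map₂_def (trans S) (trans S) (trans S) (fun _ x y => x ⊔ y)
    (fun i j h x y => map_sup (trans S i j h) x y) n x y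

/-- The order of `D(S)` is determined by its joins: `x ≤ y` iff `x ∨ y = y`. -/
noncomputable instance : SemilatticeSup (D S) :=
  @SemilatticeSup.mk' (D S) ⟨join S⟩
    (fun x y => DirectLimit.induction₂ (trans S) (C := fun x y => join S x y = join S y x)
      (fun i x y => by
        change join S (incl S i x) (incl S i y) = join S (incl S i y) (incl S i x)
        rw [join_incl, join_incl, sup_comm]) x y)
    (fun x y z => DirectLimit.induction₃ (trans S)
      (C := fun x y z => join S (join S x y) z = join S x (join S y z))
      (fun i x y z => by
        change join S (join S (incl S i x) (incl S i y)) (incl S i z) =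
          join S (incl S i x) (join S (incl S i y) (incl S i z))
        rw [join_incl, join_incl, join_incl, join_incl, sup_assoc]) x y z)
    (fun x => DirectLimit.induction (trans S) (C := fun x => join S x x = x)
      (fun i x => by
        change join S (incl S i x) (incl S i x) = incl S i x
        rw [join_incl, sup_idem]) x)

theorem incl_sup (n : ℕ) (x y : Tower S n) : incl S n (x ⊔ y) = incl S n x ⊔ incl S n y :=
  (join_incl S n x y).symm

/-- The canonical map from `S` into `D(S)`. -/
noncomputable def ofBase (a : S) : D S := incl S 0 a

theorem exists_incl (x : D S) : ∃ (n : ℕ) (y : Tower S n), x = incl S n y :=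
  DirectLimit.exists_eq_mk (trans S) x

theorem incl_mono (n : ℕ) {x y : Tower S n} (h : x ≤ y) : incl S n x ≤ incl S n y := by
  rw [← sup_eq_right, ← incl_sup, sup_eq_right.2 h]

/-- The least element of `D(S)` is the image of the least element of `S`. -/
noncomputable instance : OrderBot (D S) where
  bot := ofBase S ⊥
  bot_le x := by
    obtain ⟨n, y, rfl⟩ := exists_incl S x
    change incl S 0 (⊥ : Tower S 0) ≤ _
    rw [← incl_trans S 0 n n.zero_le, map_bot]
    exact incl_mono S n bot_le

end

section Top

variable (S : Type u) [SemilatticeSup S] [BoundedOrder S]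

theorem le_trans_top (n : ℕ) (x : Tower S n) :
    x ≤ trans S 0 n n.zero_le (show Tower S 0 from (⊤ : S)) := by
  induction n with
  | zero => rw [trans_self]; exact le_top (α := S)
  | succ n ih =>
    rw [trans_succ S 0 n n.zero_le]
    exact Reduced.le_single_iff.2 fun u v w _ => Or.inl (ih u)

/-- If `S` has a largest element `1`, then its image is the largest element of `D(S)`. -/
noncomputable instance : OrderTop (D S) where
  top := ofBase S ⊤
  le_top x := by
    obtain ⟨n, y, rfl⟩ := exists_incl S x
    change _ ≤ incl S 0 (show Tower S 0 from (⊤ : S))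
    rw [← incl_trans S 0 n n.zero_le]
    exact incl_mono S n (le_trans_top S n y)

end Top

end FreeDistrib

/-! ### The semilattices `L(Ω)` and `G(Ω)` -/

/-- The `(∨, 0, 1)`-semilattice `L(Ω)` defined by generators `1`, `a₀^ξ`, `a₁^ξ` for `ξ ∈ Ω`, and
relations `a₀^ξ ∨ a₁^ξ = 1`, in its concrete form: its elements other than `1` are the finite joins
of generators that contain no pair `a₀^ξ, a₁^ξ`, encoded by the pair `(X, Y)` of disjoint finite sets
of those `ξ` for which `a₀^ξ`, respectively `a₁^ξ`, occurs. -/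
def GenSemilattice (Ω : Type u) : Type u :=
  WithTop {p : Finset Ω × Finset Ω // Disjoint p.1 p.2}

namespace GenSemilattice

variable (Ω : Type u)

instance : PartialOrder (GenSemilattice Ω) :=
  inferInstanceAs (PartialOrder (WithTop {p : Finset Ω × Finset Ω // Disjoint p.1 p.2}))

instance : OrderTop (GenSemilattice Ω) :=
  inferInstanceAs (OrderTop (WithTop {p : Finset Ω × Finset Ω // Disjoint p.1 p.2}))

variable {Ω}

/-- The element `⋁_{ξ ∈ X} a₀^ξ ∨ ⋁_{ξ ∈ Y} a₁^ξ`. -/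
def mk (X Y : Finset Ω) (h : Disjoint X Y) : GenSemilattice Ω :=
  WithTop.some ⟨(X, Y), h⟩

theorem mk_le_mk {X Y X' Y' : Finset Ω} {h : Disjoint X Y} {h' : Disjoint X' Y'} :
    mk X Y h ≤ mk X' Y' h' ↔ X ⊆ X' ∧ Y ⊆ Y' :=
  WithTop.coe_le_coe.trans Iff.rfl

theorem not_top_le_mk {X Y : Finset Ω} {h : Disjoint X Y} : ¬ (⊤ : GenSemilattice Ω) ≤ mk X Y h :=
  WithTop.not_top_le_coe _

theorem eq_top_or_mk (x : GenSemilattice Ω) : x = ⊤ ∨ ∃ X Y h, x = mk X Y h := by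
  rcases x with _ | ⟨⟨X, Y⟩, h⟩
  · exact Or.inl rfl
  · exact Or.inr ⟨X, Y, h, rfl⟩

/-- The generator `a₀^ξ` (for `i = false`) or `a₁^ξ` (for `i = true`). -/
def gen (ξ : Ω) (i : Bool) : GenSemilattice Ω :=
  match i with
  | false => mk {ξ} ∅ (Finset.disjoint_empty_right _)
  | true => mk ∅ {ξ} (Finset.disjoint_empty_left _)

instance : OrderBot (GenSemilattice Ω) where
  bot := mk ∅ ∅ (Finset.disjoint_empty_left _)
  bot_le x := by
    rcases eq_top_or_mk x with rfl | ⟨X, Y, h, rfl⟩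
    · exact le_top
    · exact mk_le_mk.2 ⟨Finset.empty_subset _, Finset.empty_subset _⟩

instance : BoundedOrder (GenSemilattice Ω) where

theorem exists_isLUB (x y : GenSemilattice Ω) : ∃ z, IsLUB {x, y} z := by
  classical
  rcases eq_top_or_mk x with rfl | ⟨X, Y, h, rfl⟩
  · exact ⟨⊤, ⟨fun _ _ => le_top, fun b hb => hb (Set.mem_insert _ _)⟩⟩
  rcases eq_top_or_mk y with rfl | ⟨X', Y', h', rfl⟩
  · exact ⟨⊤, ⟨fun _ _ => le_top, fun b hb => hb (Set.mem_insert_of_mem _ rfl)⟩⟩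
  by_cases hd : Disjoint (X ∪ X') (Y ∪ Y')
  · refine ⟨mk _ _ hd, ?_, fun b hb => ?_⟩
    · rintro _ (rfl | rfl)
      · exact mk_le_mk.2 ⟨Finset.subset_union_left, Finset.subset_union_left⟩
      · exact mk_le_mk.2 ⟨Finset.subset_union_right, Finset.subset_union_right⟩
    · have h1 := hb (Set.mem_insert _ _)
      have h2 := hb (Set.mem_insert_of_mem _ rfl)
      rcases eq_top_or_mk b with rfl | ⟨X'', Y'', h'', rfl⟩
      · exact le_top
      · rw [mk_le_mk] at h1 h2
        exact mk_le_mk.2 ⟨Finset.union_subset h1.1 h2.1, Finset.union_subset h1.2 h2.2⟩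
  · refine ⟨⊤, fun _ _ => le_top, fun b hb => ?_⟩
    have h1 := hb (Set.mem_insert _ _)
    have h2 := hb (Set.mem_insert_of_mem _ rfl)
    rcases eq_top_or_mk b with rfl | ⟨X'', Y'', h'', rfl⟩
    · exact le_rfl
    · rw [mk_le_mk] at h1 h2
      exact absurd (Finset.disjoint_of_subset_left (Finset.union_subset h1.1 h2.1)
        (Finset.disjoint_of_subset_right (Finset.union_subset h1.2 h2.2) h'')) hd

/-- The join of two elements is their least upper bound. -/
noncomputable instance : SemilatticeSup (GenSemilattice Ω) where
  sup x y := (exists_isLUB x y).choose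
  le_sup_left x y := (exists_isLUB x y).choose_spec.1 (Set.mem_insert _ _)
  le_sup_right x y := (exists_isLUB x y).choose_spec.1 (Set.mem_insert_of_mem _ rfl)
  sup_le x y z hx hy := (exists_isLUB x y).choose_spec.2 (by
    rintro _ (rfl | rfl)
    · exact hx
    · exact hy)

/-- The defining relations `a₀^ξ ∨ a₁^ξ = 1`. -/
theorem gen_sup_gen (ξ : Ω) : gen ξ false ⊔ gen ξ true = ⊤ := by
  rcases eq_top_or_mk (gen ξ false ⊔ gen ξ true) with h | ⟨X, Y, hd, h⟩
  · exact h
  · have h1 : gen ξ false ≤ mk X Y hd := h ▸ le_sup_left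
    have h2 : gen ξ true ≤ mk X Y hd := h ▸ le_sup_right
    have h1' := (mk_le_mk.1 h1).1 (Finset.mem_singleton_self ξ)
    have h2' := (mk_le_mk.1 h2).2 (Finset.mem_singleton_self ξ)
    exact absurd h2' (Finset.disjoint_left.1 hd h1')

end GenSemilattice

/-- `G(Ω) = D(L(Ω))`. -/
abbrev GSemilattice (Ω : Type u) : Type u := FreeDistrib.D (GenSemilattice Ω)

/-!
Suppose that `μ : Con_c L → G(Ω)` is weakly distributive with `μ(θ) = 1`. The congruence `θ` may be
taken to be a finite join of congruences `Θ(e, 1)`, where `1` is the largest element of `L`, and it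
suffices to show that `μ(Θ(e, 1)) = 0` for each of these `e` (`map_concPrincipal_top_eq_bot`).

For each `ξ ∈ Ω`, weak distributivity at `1 = a₀^ξ ∨ a₁^ξ` gives `θ ≤ φ₀ ∨ φ₁` with `μ(φ_j) ≤ a_j^ξ`,
and hence a chain `e = z₀^ξ, z₁^ξ, …, z_n^ξ = 1` in `L` whose steps belong alternately to `φ₀` and to
`φ₁`. As `|Ω| ≥ ℵ_{ω+1}`, for some `N` at least `ℵ_{2^N}` many `ξ` have a chain of the same length
`N` (`exists_large_fiber`), and Kuratowski's Free Set Theorem (`exists_free_finset`) yields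
`2^N + 1` such indices that are independent: the congruences built from the chains of some of them
have images whose supports avoid the others.

For such indices, descending induction on `i` shows `μ(Θ(⋁_{ξ ∈ B} zᵢ^ξ, 1)) = 0` whenever `B` has
`2^(N - i)` elements; the case `i = 0` is the claim. In the induction step, `B` is halved into `B₀`
and `B₁`, with joins `x₀` and `x₁`, and a further index `δ` is chosen. Joining the chain of `δ` with
`x₀` and with `x₁` gives congruences `θ₀`, `θ₁` with `Θ(x₀ ∨ x₁, 1) ≤ θ₀ ∨ θ₁`, where `μ(θ_j)` is below
both `a_j^δ` and `⋁_{ξ ∈ B_j} a_k^ξ`, with `k` the parity of `i` (Erosion Lemma,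
`concPrincipal_le_erosion_sup`). By independence, the supports of `μ(θ₀)`, `μ(θ₁)` and
`μ(Θ(x₀ ∨ x₁, 1))` avoid `B₁`, `B₀` and `δ` respectively, and in `G(Ω)` these conditions force
`μ(Θ(x₀ ∨ x₁, 1)) = 0` (Evaporation Lemma, `GSemilattice.evaporation`).

The Evaporation Lemma is proved level by level along the tower `Rⁿ(L(Ω))`. Supports are described by
a predicate on `L(Ω)` that is required hereditarily of all entries of a reduced set. What carries the
induction is that `Separates` passes from `S` to `R(S)`: joining with generators
whose indices avoid the supports of `b` and `p` creates no new inequality: `b ≤ p ∨ t` gives `b ≤ p`.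
-/

/-! ### Separation and evaporation in a single free extension -/

namespace Reduced

variable {S : Type u} [SemilatticeSup S]

/-- The reduced sets all of whose entries satisfy `P`. -/
def All (P : S → Prop) (x : Reduced S) : Prop :=
  ∀ u v w, (u, v, w) ∈ x.carrier → P u ∧ P v ∧ P w

theorem All.proj {P : S → Prop} {x : Reduced S} (h : x.All P) : P x.proj :=
  (h _ _ _ x.proj_mem).1

theorem all_single {P : S → Prop} {a : S} (h : P a) : (single a).All P := by
  intro u v w hm
  simp only [single, Finset.mem_singleton, Prod.mk.injEq] at hm
  obtain ⟨rfl, rfl, rfl⟩ := hm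
  exact ⟨h, h, h⟩

theorem single_injective : Function.Injective (single : S → Reduced S) :=
  fun _ _ h => congrArg Reduced.proj h

/-- In a reduced set, the rule `v ≤ π ⟹ w ≤ π` holds, since only the diagonal triple can have
`v ≤ π`. -/
theorem le_proj_of_mem {x : Reduced S} {u v w : S} (hm : (u, v, w) ∈ x.carrier)
    (hv : v ≤ x.proj) : w ≤ x.proj := by
  by_cases hne : (u, v, w) = (x.proj, x.proj, x.proj)
  · simp only [Prod.mk.injEq] at hne
    exact hne.2.2.le
  · exact absurd hv (x.not_le_proj u v w hm hne).2.1

/-- A criterion for the projection of a join not to exceed `q`; the two rules need checking only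
where they do not already hold inside `x` or inside `y`. -/
theorem proj_sup_le {x y : Reduced S} {q : S} (hx : x.proj ≤ q) (hy : y.proj ≤ q)
    (hxy : ∀ a b c, (a, b, c) ∈ x.carrier → (b, a, c) ∈ y.carrier → c ≤ q)
    (hx' : ∀ a b c, (a, b, c) ∈ x.carrier → b ≤ q → c ≤ q)
    (hy' : ∀ a b c, (a, b, c) ∈ y.carrier → b ≤ q → c ≤ q) : (x ⊔ y).proj ≤ q := by
  classical
  have diag : ∀ z : Reduced S, z.proj ≤ q → ∀ a b c, (a, b, c) ∈ z.carrier →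
      (b, a, c) ∈ z.carrier → c ≤ q := by
    intro z hz a b c h h'
    obtain ⟨rfl, rfl⟩ := z.eq_of_mem_swap a b c h h'
    exact ((z.diag_mem_iff _).1 h).le.trans hz
  refine supProj_le x y q fun a b c h h' => ?_
  rcases Finset.mem_union.1 h with h | h
  · rcases h' with h' | h'
    · exact (Finset.mem_union.1 h').elim (diag x hx a b c h) (hxy a b c h)
    · exact hx' a b c h h'
  · rcases h' with h' | h'
    · exact (Finset.mem_union.1 h').elim (fun h' => hxy b a c h' h) (diag y hy a b c h)
    · exact hy' a b c h h'

theorem mem_or_le_of_le_sup {x y z : Reduced S} (h : z ≤ x ⊔ y) {u v w : S}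
    (hm : (u, v, w) ∈ z.carrier) :
    (u, v, w) ∈ x.carrier ∨ (u, v, w) ∈ y.carrier ∨ u ≤ (x ⊔ y).proj ∨ w ≤ (x ⊔ y).proj := by
  classical
  by_cases hs : (u, v, w) ∈ (x ⊔ y).carrier
  · rcases Finset.mem_insert.1 hs with he | hf
    · exact Or.inr (Or.inr (Or.inl (congrArg Prod.fst he).le))
    · exact (Finset.mem_union.1 (Finset.mem_filter.1 hf).1).imp id Or.inl
  · exact Or.inr (Or.inr (h u v w hm hs))

end Reduced

section Semilattice

variable {S : Type u} [SemilatticeSup S]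

/-- Joining with `t` creates no new inequality between elements that satisfy `P`. In the
application, `P` describes the elements whose support avoids a finite set `A`, and `t` is a join of
generators with indices in `A`. -/
def Separates (P : S → Prop) (t : S) : Prop :=
  ∀ b p, P b → P p → b ≤ p ⊔ t → b ≤ p

theorem Separates.le_bot [OrderBot S] {P : S → Prop} {t b : S} (h : Separates P t) (h0 : P ⊥)
    (hb : P b) (hbt : b ≤ t) : b ≤ ⊥ :=
  h b ⊥ hb h0 (hbt.trans le_sup_right)

theorem Separates.single {P : S → Prop} {t : S} (h : Separates P t) :
    Separates (Reduced.All P) (Reduced.single t) := by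
  intro b p hb hp hbp
  have hproj : (p ⊔ Reduced.single t).proj ≤ p.proj ⊔ t := by
    have hrule : ∀ a b c, (a, b, c) ∈ (Reduced.single t).carrier → c = t := by
      intro a b c hm
      simp only [Reduced.single, Finset.mem_singleton, Prod.mk.injEq] at hm
      exact hm.2.2
    refine Reduced.proj_sup_le le_sup_left le_sup_right
      (fun a b c _ h' => (hrule b a c h').le.trans le_sup_right) (fun a b c hm hq => ?_)
      (fun a b c hm _ => (hrule a b c hm).le.trans le_sup_right)
    exact (Reduced.le_proj_of_mem hm (h b _ (hp a b c hm).2.1 hp.proj hq)).trans le_sup_left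
  intro u v w hm hn
  have hP := hb u v w hm
  rcases Reduced.mem_or_le_of_le_sup hbp hm with h1 | h1 | h1 | h1
  · exact absurd h1 hn
  · simp only [Reduced.single, Finset.mem_singleton, Prod.mk.injEq] at h1
    exact Or.inl (h u _ hP.1 hp.proj (h1.1.le.trans le_sup_right))
  · exact Or.inl (h u _ hP.1 hp.proj (h1.trans hproj))
  · exact Or.inr (h w _ hP.2.2 hp.proj (h1.trans hproj))

/-- The conclusion of the Evaporation Lemma: an element of `Q` is zero if it lies below `x ∨ y`
where `x` satisfies `P₁` and is below `d₀` and `t₀`, while `y` satisfies `P₀` and is below `d₁` and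
`t₁`. -/
def Evaporates [OrderBot S] (P₀ P₁ Q : S → Prop) (t₀ t₁ d₀ d₁ : S) : Prop :=
  ∀ x y z, P₁ x → P₀ y → Q z → x ≤ d₀ → x ≤ t₀ → y ≤ d₁ → y ≤ t₁ → z ≤ x ⊔ y → z ≤ ⊥

/-- Evaporation passes from `S` to `R(S)`. The separation hypotheses show that the join of `x` and
`y` is little more than the union of the two sets of triples: its projection is the join of the
projections, to which evaporation in `S` applies. -/
theorem Evaporates.single [OrderBot S] {P₀ P₁ Q : S → Prop} {t₀ t₁ d₀ d₁ : S}
    (h : Evaporates P₀ P₁ Q t₀ t₁ d₀ d₁) (hP₀ : P₀ ⊥) (hP₁ : P₁ ⊥) (hQ : Q ⊥)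
    (h₀ : Separates P₀ t₀) (h₁ : Separates P₁ t₁) (hd₀ : Separates Q d₀) (hd₁ : Separates Q d₁) :
    Evaporates (Reduced.All P₀) (Reduced.All P₁) (Reduced.All Q) (Reduced.single t₀)
      (Reduced.single t₁) (Reduced.single d₀) (Reduced.single d₁) := by
  intro x y z hx hy hz hxd hxt hyd hyt hzxy
  have hxd' : x.proj ≤ d₀ := Reduced.proj_mono hxd
  have hxt' : x.proj ≤ t₀ := Reduced.proj_mono hxt
  have hyd' : y.proj ≤ d₁ := Reduced.proj_mono hyd
  have hyt' : y.proj ≤ t₁ := Reduced.proj_mono hyt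
  rw [Reduced.le_single_iff] at hxd hxt hyd hyt
  have hproj : (x ⊔ y).proj ≤ x.proj ⊔ y.proj := by
    refine Reduced.proj_sup_le le_sup_left le_sup_right (fun a b c hm hm' => ?_)
      (fun a b c hm hb => ?_) (fun a b c hm hb => ?_)
    · -- The entries of a triple common to `x` and `y` satisfy both `P₀` and `P₁`, so `a`, `b`, `c`
      -- vanish as soon as they lie below `t₀` or `t₁`.
      have hPx := hx a b c hm
      have hPy := hy b a c hm'
      refine le_trans ?_ (bot_le : ⊥ ≤ x.proj ⊔ y.proj)
      rcases hxt a b c hm with ha | hc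
      · rcases hyt b a c hm' with hb | hc
        · exact (x.le_sup a b c hm).trans
            (sup_le (h₀.le_bot hP₀ hPy.2.1 ha) (h₁.le_bot hP₁ hPx.2.1 hb))
        · exact h₁.le_bot hP₁ hPx.2.2 hc
      · exact h₀.le_bot hP₀ hPy.2.2 hc
    · exact (Reduced.le_proj_of_mem hm (h₁ b _ (hx a b c hm).2.1 hx.proj
        (hb.trans (sup_le_sup_left hyt' _)))).trans le_sup_left
    · refine (Reduced.le_proj_of_mem hm (h₀ b _ (hy a b c hm).2.1 hy.proj
        (hb.trans ?_))).trans le_sup_right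
      rw [sup_comm]
      exact sup_le_sup_left hxt' _
  refine Reduced.le_single_iff.2 fun u v w hm => ?_
  have hzm := hz u v w hm
  rcases Reduced.mem_or_le_of_le_sup hzxy hm with h1 | h1 | h1 | h1
  · exact (hxd u v w h1).imp (hd₀.le_bot hQ hzm.1) (hd₀.le_bot hQ hzm.2.2)
  · exact (hyd u v w h1).imp (hd₁.le_bot hQ hzm.1) (hd₁.le_bot hQ hzm.2.2)
  · exact Or.inl (h _ _ u hx.proj hy.proj hzm.1 hxd' hxt' hyd' hyt' (h1.trans hproj))
  · exact Or.inr (h _ _ w hx.proj hy.proj hzm.2.2 hxd' hxt' hyd' hyt' (h1.trans hproj))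

end Semilattice

/-! ### Supports and evaporation in the union of the tower -/

namespace FreeDistrib

section Tower

variable {S : Type u} [SemilatticeSup S] [OrderBot S]

/-- The extension of a predicate on `S` to `Rⁿ(S)`: all entries occurring hereditarily in the
element satisfy `P`. -/
def TowerAll (P : S → Prop) : ∀ n : ℕ, Tower S n → Prop
  | 0 => P
  | n + 1 => Reduced.All (TowerAll P n)

/-- The image in `Rⁿ(S)` of an element of `S`. -/
noncomputable def base (n : ℕ) (a : S) : Tower S n :=
  trans S 0 n n.zero_le (show Tower S 0 from a)

theorem base_zero (a : S) : base 0 a = a := by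
  unfold base
  rw [trans_self]
  rfl

theorem base_succ (n : ℕ) (a : S) : base (n + 1) a = Reduced.single (base n a) := by
  unfold base
  rw [trans_succ S 0 n n.zero_le]
  rfl

theorem incl_base (n : ℕ) (a : S) : incl S n (base n a) = ofBase S a :=
  incl_trans S 0 n n.zero_le _

theorem trans_injective (m n : ℕ) (h : m ≤ n) : Function.Injective (trans S m n h) := by
  induction n, h using Nat.le_induction with
  | base => rw [trans_self]; exact fun _ _ h => h
  | succ n hn ih =>
    rw [trans_succ S m n hn]
    exact fun x y hxy => ih (Reduced.single_injective hxy)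

theorem incl_le_incl {n : ℕ} {x y : Tower S n} : incl S n x ≤ incl S n y ↔ x ≤ y := by
  refine ⟨fun h => ?_, incl_mono S n⟩
  rw [← sup_eq_right, ← incl_sup] at h
  exact sup_eq_right.1 (DirectLimit.mk_injective (trans S) trans_injective n h)

theorem ofBase_le_ofBase {a b : S} : ofBase S a ≤ ofBase S b ↔ a ≤ b :=
  incl_le_incl (n := 0)

theorem TowerAll.trans {P : S → Prop} {m n : ℕ} (h : m ≤ n) {x : Tower S m}
    (hx : TowerAll P m x) : TowerAll P n (FreeDistrib.trans S m n h x) := by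
  induction n, h using Nat.le_induction with
  | base => rw [trans_self]; exact hx
  | succ n hn ih =>
    rw [trans_succ S m n hn]
    exact Reduced.all_single ih

theorem TowerAll.mono {P Q : S → Prop} (h : ∀ a, P a → Q a) (n : ℕ) (x : Tower S n)
    (hx : TowerAll P n x) : TowerAll Q n x := by
  induction n with
  | zero => exact h _ hx
  | succ n ih => exact fun u v w hm => (hx u v w hm).imp (ih u) (And.imp (ih v) (ih w))

theorem towerAll_bot {P : S → Prop} (h : P ⊥) (n : ℕ) : TowerAll P n ⊥ := by
  induction n with
  | zero => exact h
  | succ n ih => exact Reduced.all_single ih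

theorem separates_tower {P : S → Prop} {t : S} (h : Separates P t) (n : ℕ) :
    Separates (TowerAll P n) (base n t) := by
  induction n with
  | zero => rw [base_zero]; exact h
  | succ n ih => rw [base_succ]; exact ih.single

theorem evaporates_tower {P₀ P₁ Q : S → Prop} {t₀ t₁ d₀ d₁ : S}
    (h : Evaporates P₀ P₁ Q t₀ t₁ d₀ d₁) (hP₀ : P₀ ⊥) (hP₁ : P₁ ⊥) (hQ : Q ⊥)
    (h₀ : Separates P₀ t₀) (h₁ : Separates P₁ t₁) (hd₀ : Separates Q d₀) (hd₁ : Separates Q d₁)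
    (n : ℕ) : Evaporates (TowerAll P₀ n) (TowerAll P₁ n) (TowerAll Q n) (base n t₀) (base n t₁)
      (base n d₀) (base n d₁) := by
  induction n with
  | zero => simp only [base_zero]; exact h
  | succ n ih =>
    simp only [base_succ]
    exact ih.single (towerAll_bot hP₀ n) (towerAll_bot hP₁ n) (towerAll_bot hQ n)
      (separates_tower h₀ n) (separates_tower h₁ n) (separates_tower hd₀ n)
      (separates_tower hd₁ n)

/-- The extension of a predicate on `S` to `D(S)`: some representative satisfies it hereditarily. -/
def DAll (P : S → Prop) (x : D S) : Prop :=
  ∃ (n : ℕ) (y : Tower S n), x = incl S n y ∧ TowerAll P n y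

theorem DAll.exists_of_le {P : S → Prop} {x : D S} (h : DAll P x) :
    ∃ m, ∀ n, m ≤ n → ∃ y : Tower S n, x = incl S n y ∧ TowerAll P n y := by
  obtain ⟨m, y, rfl, hy⟩ := h
  exact ⟨m, fun n hn => ⟨trans S m n hn y, (incl_trans S m n hn y).symm, hy.trans hn⟩⟩

theorem evaporates_D {P₀ P₁ Q : S → Prop} {t₀ t₁ d₀ d₁ : S}
    (h : Evaporates P₀ P₁ Q t₀ t₁ d₀ d₁) (hP₀ : P₀ ⊥) (hP₁ : P₁ ⊥) (hQ : Q ⊥)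
    (h₀ : Separates P₀ t₀) (h₁ : Separates P₁ t₁) (hd₀ : Separates Q d₀) (hd₁ : Separates Q d₁) :
    Evaporates (DAll P₀) (DAll P₁) (DAll Q) (ofBase S t₀) (ofBase S t₁) (ofBase S d₀)
      (ofBase S d₁) := by
  intro x y z hx hy hz hxd hxt hyd hyt hzxy
  obtain ⟨k, hk⟩ := hx.exists_of_le
  obtain ⟨l, hl⟩ := hy.exists_of_le
  obtain ⟨m, hm⟩ := hz.exists_of_le
  let n := max k (max l m)
  obtain ⟨x', rfl, hx'⟩ := hk n (by omega)
  obtain ⟨y', rfl, hy'⟩ := hl n (by omega)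
  obtain ⟨z', rfl, hz'⟩ := hm n (by omega)
  rw [← incl_base n, incl_le_incl] at hxd hxt hyd hyt
  rw [← incl_sup, incl_le_incl] at hzxy
  have hbot := evaporates_tower h hP₀ hP₁ hQ h₀ h₁ hd₀ hd₁ n x' y' z' hx' hy' hz' hxd hxt hyd
    hyt hzxy
  exact (incl_mono S n hbot).trans (by rw [← map_bot (trans S 0 n n.zero_le), incl_trans]; rfl)

end Tower

end FreeDistrib

namespace GenSemilattice

variable {Ω : Type u}

/-- The element `⋁_{ξ ∈ A} aᵢ^ξ`. -/
def genSup (i : Bool) (A : Finset Ω) : GenSemilattice Ω :=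
  match i with
  | false => mk A ∅ (Finset.disjoint_empty_right _)
  | true => mk ∅ A (Finset.disjoint_empty_left _)

theorem genSup_singleton (i : Bool) (ξ : Ω) : genSup i {ξ} = gen ξ i := by
  cases i <;> rfl

theorem genSup_mono {i : Bool} {A B : Finset Ω} (h : A ⊆ B) : genSup i A ≤ genSup i B := by
  cases i
  · exact mk_le_mk.2 ⟨h, Finset.Subset.rfl⟩
  · exact mk_le_mk.2 ⟨Finset.Subset.rfl, h⟩

/-- The element lies in the subsemilattice generated by `1` and the `aᵢ^ξ` with `ξ ∈ W`. -/
def SupportedBy (W : Finset Ω) (x : GenSemilattice Ω) : Prop :=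
  ∀ X Y h, x = mk X Y h → X ⊆ W ∧ Y ⊆ W

theorem mk_injective {X Y X' Y' : Finset Ω} {h : Disjoint X Y} {h' : Disjoint X' Y'}
    (he : mk X Y h = mk X' Y' h') : X = X' ∧ Y = Y' := by
  have h1 := mk_le_mk.1 he.le
  have h2 := mk_le_mk.1 he.ge
  exact ⟨h1.1.antisymm h2.1, h1.2.antisymm h2.2⟩

theorem supportedBy_mk {W X Y : Finset Ω} {h : Disjoint X Y} :
    SupportedBy W (mk X Y h) ↔ X ⊆ W ∧ Y ⊆ W := by
  refine ⟨fun hs => hs X Y h rfl, fun hs X' Y' h' he => ?_⟩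
  obtain ⟨rfl, rfl⟩ := mk_injective he
  exact hs

theorem supportedBy_bot (W : Finset Ω) : SupportedBy W (⊥ : GenSemilattice Ω) :=
  supportedBy_mk.2 ⟨Finset.empty_subset _, Finset.empty_subset _⟩

theorem SupportedBy.mono {W W' : Finset Ω} (h : W ⊆ W') (x : GenSemilattice Ω)
    (hx : SupportedBy W x) : SupportedBy W' x :=
  fun X Y hd he => (hx X Y hd he).imp (fun h' => h'.trans h) (fun h' => h'.trans h)

theorem exists_supportedBy (x : GenSemilattice Ω) : ∃ W, SupportedBy W x := by
  classical
  rcases eq_top_or_mk x with rfl | ⟨X, Y, h, rfl⟩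
  · exact ⟨∅, fun X Y h he => absurd he.le not_top_le_mk⟩
  · exact ⟨X ∪ Y, supportedBy_mk.2 ⟨Finset.subset_union_left, Finset.subset_union_right⟩⟩

theorem separates {W A : Finset Ω} (hWA : Disjoint W A) (i : Bool) :
    Separates (SupportedBy W) (genSup i A) := by
  classical
  intro b p hb hp hbp
  rcases eq_top_or_mk p with rfl | ⟨X, Y, h, rfl⟩
  · exact le_top
  have hp := supportedBy_mk.1 hp
  have cancel : ∀ {U V : Finset Ω}, U ⊆ W → U ⊆ V ∪ A → U ⊆ V := fun hU hUV ξ hξ =>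
    (Finset.mem_union.1 (hUV hξ)).resolve_right (Finset.disjoint_left.1 hWA (hU hξ))
  -- As `A` avoids the support of `p`, the join `p ∨ ⋁_{ξ ∈ A} aᵢ^ξ` is still of the form `mk _ _`.
  cases i
  · have hd : Disjoint (X ∪ A) Y := Finset.disjoint_union_left.2
      ⟨h, (Finset.disjoint_of_subset_left hp.2 hWA).symm⟩
    have hle : b ≤ mk (X ∪ A) Y hd := hbp.trans (sup_le
      (mk_le_mk.2 ⟨Finset.subset_union_left, Finset.Subset.rfl⟩)
      (mk_le_mk.2 ⟨Finset.subset_union_right, Finset.empty_subset _⟩))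
    rcases eq_top_or_mk b with rfl | ⟨X', Y', h', rfl⟩
    · exact absurd hle not_top_le_mk
    · have hb := supportedBy_mk.1 hb
      exact mk_le_mk.2 ((mk_le_mk.1 hle).imp (cancel hb.1) id)
  · have hd : Disjoint X (Y ∪ A) := Finset.disjoint_union_right.2
      ⟨h, Finset.disjoint_of_subset_left hp.1 hWA⟩
    have hle : b ≤ mk X (Y ∪ A) hd := hbp.trans (sup_le
      (mk_le_mk.2 ⟨Finset.Subset.rfl, Finset.subset_union_left⟩)
      (mk_le_mk.2 ⟨Finset.empty_subset _, Finset.subset_union_right⟩))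
    rcases eq_top_or_mk b with rfl | ⟨X', Y', h', rfl⟩
    · exact absurd hle not_top_le_mk
    · have hb := supportedBy_mk.1 hb
      exact mk_le_mk.2 ((mk_le_mk.1 hle).imp id (cancel hb.2))

theorem le_bot_of_le_genSup {A B : Finset Ω} (hAB : Disjoint A B) {i j : Bool}
    {x : GenSemilattice Ω} (hA : x ≤ genSup i A) (hB : x ≤ genSup j B) : x ≤ ⊥ := by
  rcases eq_top_or_mk x with rfl | ⟨X, Y, h, rfl⟩
  · cases i <;> exact absurd hA not_top_le_mk
  · refine mk_le_mk.2 ?_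
    cases i <;> cases j <;>
    · have h1 := mk_le_mk.1 hA
      have h2 := mk_le_mk.1 hB
      constructor
      · intro ξ hξ
        first
          | exact h1.1 hξ
          | exact h2.1 hξ
          | exact absurd (h2.1 hξ) (Finset.disjoint_left.1 hAB (h1.1 hξ))
      · intro ξ hξ
        first
          | exact h1.2 hξ
          | exact h2.2 hξ
          | exact absurd (h2.2 hξ) (Finset.disjoint_left.1 hAB (h1.2 hξ))

end GenSemilattice

namespace GSemilattice

open FreeDistrib GenSemilattice

variable {Ω : Type u}

/-- The element of `G(Ω)` lies in the image of `G(W)`. -/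
def SupportedBy (W : Finset Ω) (x : GSemilattice Ω) : Prop :=
  DAll (GenSemilattice.SupportedBy W) x

theorem exists_towerAll (n : ℕ) (x : Tower (GenSemilattice Ω) n) :
    ∃ W, TowerAll (GenSemilattice.SupportedBy W) n x := by
  classical
  induction n with
  | zero => exact exists_supportedBy (Ω := Ω) x
  | succ n ih =>
    choose W hW using ih
    let V (t : Tower (GenSemilattice Ω) n × Tower (GenSemilattice Ω) n ×
      Tower (GenSemilattice Ω) n) : Finset Ω := W t.1 ∪ (W t.2.1 ∪ W t.2.2)
    refine ⟨(Reduced.carrier x).biUnion V, fun u v w hm => ?_⟩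
    have hV : W u ∪ (W v ∪ W w) ⊆ (Reduced.carrier x).biUnion V :=
      Finset.subset_biUnion_of_mem V hm
    have hvw := Finset.union_subset_right hV
    exact ⟨(hW u).mono (SupportedBy.mono (Finset.union_subset_left hV)) n u,
      (hW v).mono (SupportedBy.mono (Finset.union_subset_left hvw)) n v,
      (hW w).mono (SupportedBy.mono (Finset.union_subset_right hvw)) n w⟩

theorem exists_supportedBy (x : GSemilattice Ω) : ∃ W, SupportedBy W x := by
  obtain ⟨n, y, rfl⟩ := exists_incl _ x
  obtain ⟨W, hW⟩ := exists_towerAll n y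
  exact ⟨W, n, y, rfl, hW⟩

/-- The Evaporation Lemma: if `z ≤ x ∨ y`, where `x` and `y` are bounded by the two complementary
generators at `δ` and also by joins of generators over `A₀` and `A₁`, while the supports of `x`, `y`
and `z` avoid `A₁`, `A₀` and `δ`, then `z = 0`. -/
theorem evaporation {A₀ A₁ W₀ W₁ W : Finset Ω} {δ : Ω} {i : Bool} (hδ₀ : δ ∉ A₀) (hδ₁ : δ ∉ A₁)
    (hW₀ : Disjoint W₀ A₁) (hW₁ : Disjoint W₁ A₀) (hW : δ ∉ W) {x y z : GSemilattice Ω}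
    (hx : SupportedBy W₀ x) (hy : SupportedBy W₁ y) (hz : SupportedBy W z)
    (hxδ : x ≤ ofBase _ (gen δ false)) (hxA : x ≤ ofBase _ (genSup i A₀))
    (hyδ : y ≤ ofBase _ (gen δ true)) (hyA : y ≤ ofBase _ (genSup i A₁))
    (hzxy : z ≤ x ⊔ y) : z = ⊥ := by
  have hWδ : Disjoint W {δ} := Finset.disjoint_singleton_right.2 hW
  rw [← genSup_singleton] at hxδ hyδ
  refine le_bot_iff.1 (evaporates_D ?_ (supportedBy_bot _) (supportedBy_bot _)
    (supportedBy_bot _) (separates hW₁ i) (separates hW₀ i) (separates hWδ false)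
    (separates hWδ true) x y z hx hy hz hxδ hxA hyδ hyA hzxy)
  intro x y z _ _ _ hxδ hxA hyδ hyA hzxy
  exact hzxy.trans (sup_le
    (le_bot_of_le_genSup (Finset.disjoint_singleton_left.2 hδ₀) hxδ hxA)
    (le_bot_of_le_genSup (Finset.disjoint_singleton_left.2 hδ₁) hyδ hyA))

theorem bot_ne_top : (⊥ : GSemilattice Ω) ≠ ⊤ := fun h =>
  not_top_le_mk (ofBase_le_ofBase.1 h.ge)

theorem ofBase_gen_sup (ξ : Ω) :
    ofBase _ (gen ξ false) ⊔ ofBase _ (gen ξ true) = (⊤ : GSemilattice Ω) := by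
  refine (incl_sup _ 0 _ _).symm.trans ?_
  exact congrArg (ofBase _) (gen_sup_gen ξ)

end GSemilattice

/-! ### Free sets -/

open Cardinal in
/-- Kuratowski's Free Set Theorem, for set mappings defined on all finite sets. The inductive step
fixes a subset `Y` of size `ℵ_m` and a point `x` outside all the sets `Φ F` with `F ⊆ Y`, and applies
the induction hypothesis inside `Y` to `F ↦ Φ F ∪ Φ (F ∪ {x})`. -/
theorem exists_free_finset {Ω : Type u} (m : ℕ) (X : Set Ω) (hX : ℵ_ m ≤ #X)
    (Φ : Finset Ω → Finset Ω) :
    ∃ H : Finset Ω, ↑H ⊆ X ∧ H.card = m + 1 ∧ ∀ F ⊆ H, ∀ h ∈ H, h ∉ F → h ∉ Φ F := by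
  classical
  induction m generalizing X Φ with
  | zero =>
    have hinf : X.Infinite := by
      rw [← Set.infinite_coe_iff, Cardinal.infinite_iff]
      simpa using hX
    obtain ⟨x, hx, hxΦ⟩ := hinf.exists_notMem_finset (Φ ∅)
    refine ⟨{x}, by simpa using hx, by simp, fun F hF h hh hhF => ?_⟩
    obtain rfl := Finset.mem_singleton.1 hh
    rcases Finset.subset_singleton_iff.1 hF with rfl | rfl
    · exact hxΦ
    · exact absurd (Finset.mem_singleton_self h) hhF
  | succ m ih =>
    have hlt : ℵ_ (m : Ordinal) < ℵ_ ((m + 1 : ℕ) : Ordinal) :=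
      aleph_lt_aleph.2 (by exact_mod_cast m.lt_succ_self)
    obtain ⟨Y, hYX, hY⟩ := le_mk_iff_exists_subset.1 (hlt.le.trans hX)
    have hYinf : Infinite Y := by
      rw [Cardinal.infinite_iff, hY]
      exact aleph0_le_aleph _
    -- `Z` consists of `Y` and the sets `Φ F` for `F ⊆ Y`, so it has fewer than `#X` elements.
    let Z : Set Ω := Y ∪ ⋃ F : Finset Y, ↑(Φ (F.map (Function.Embedding.subtype _)))
    have hZ : #Z ≤ ℵ_ (m : Ordinal) := by
      refine (mk_union_le _ _).trans (add_le_of_le (aleph0_le_aleph _) hY.le ?_)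
      refine (mk_iUnion_le _).trans (mul_le_of_le (aleph0_le_aleph _) ?_ ?_)
      · rw [mk_finset_of_infinite, hY]
      · exact ciSup_le' fun F => ((finset_card_lt_aleph0 _).le.trans (aleph0_le_aleph _))
    obtain ⟨x, hxX, hxZ⟩ : ∃ x ∈ X, x ∉ Z := by
      by_contra! hcon
      exact absurd (hX.trans ((mk_le_mk_of_subset hcon).trans hZ)) (not_le.2 hlt)
    obtain ⟨H, hHY, hcard, hH⟩ := ih Y hY.ge fun F => Φ F ∪ Φ (insert x F)
    have hxH : x ∉ H := fun h => hxZ (Or.inl (hHY h))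
    refine ⟨insert x H, ?_, by rw [Finset.card_insert_of_notMem hxH, hcard], ?_⟩
    · rw [Finset.coe_insert]
      exact Set.insert_subset hxX (hHY.trans hYX)
    · intro F hF h hh hhF
      rcases Finset.mem_insert.1 hh with rfl | hh
      · have hFH : F ⊆ H := (Finset.subset_insert_iff_of_notMem hhF).1 hF
        refine fun hhΦ => hxZ (Or.inr (Set.mem_iUnion.2 ⟨F.subtype (· ∈ Y), ?_⟩))
        rwa [Finset.subtype_map_of_mem fun y hy => hHY (hFH hy)]
      · have key := hH (F.erase x) (Finset.subset_insert_iff.1 hF) h hh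
          fun h' => hhF (Finset.mem_of_mem_erase h')
        rw [Finset.notMem_union] at key
        by_cases hxF : x ∈ F
        · rw [← Finset.insert_erase hxF]
          exact key.2
        · rw [← Finset.erase_eq_of_notMem hxF]
          exact key.1

open Cardinal in
/-- A set of size at least `ℵ_{ω+1}` that is split into countably many pieces has a piece of size at
least `ℵ_{f N}`, for any prescribed function `f`. -/
theorem exists_large_fiber {Ω : Type u} (hΩ : ℵ_ (Ordinal.omega0 + 1) ≤ #Ω) (n : Ω → ℕ)
    (f : ℕ → ℕ) : ∃ N, ℵ_ (f N : Ordinal) ≤ #{ξ | n ξ = N} := by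
  by_contra! hcon
  have hcover : #Ω ≤ ℵ_ Ordinal.omega0 := by
    have huniv : (⋃ N : ULift.{u} ℕ, {ξ | n ξ = N.down}) = Set.univ :=
      Set.eq_univ_of_forall fun ξ => Set.mem_iUnion.2 ⟨⟨n ξ⟩, rfl⟩
    rw [← mk_univ, ← huniv]
    refine (mk_iUnion_le _).trans (mul_le_of_le (aleph0_le_aleph _) ?_ ?_)
    · rw [mk_uLift, mk_nat, lift_aleph0]
      exact aleph0_le_aleph _
    · exact ciSup_le' fun N => (hcon N.down).le.trans
        (aleph_le_aleph.2 (Ordinal.natCast_lt_omega0 _).le)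
  exact absurd (hΩ.trans hcover) (not_le.2 (aleph_lt_aleph.2 (lt_add_one _)))

/-! ### Congruences -/

namespace Operations

variable {L : Type v} (A : Operations.{v, w} L)

variable {A} in
theorem principal_le {x y : L} {c : A.Congruence} : A.principal x y ≤ c ↔ c.rel x y :=
  ⟨fun h => h x y fun _ hd => hd, fun h _ _ huv => huv c h⟩

theorem principal_rel (x y : L) : (A.principal x y).rel x y := principal_le.1 le_rfl

open Relation in
/-- The join of two congruences is the transitive closure of their union. -/
theorem reflTransGen_of_sup_rel {c d : A.Congruence} {x y : L} (h : (c ⊔ d).rel x y) :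
    ReflTransGen (fun x y => c.rel x y ∨ d.rel x y) x y := by
  classical
  let r : L → L → Prop := fun x y => c.rel x y ∨ d.rel x y
  have hop : ∀ (i : A.Index) (k : Fin (A.arity i)) (x : Fin (A.arity i) → L) {a b : L}, r a b →
      r (A.op i (Function.update x k a)) (A.op i (Function.update x k b)) := by
    intro i k x a b hab
    refine hab.imp (fun hab => c.compat i _ _ fun l => ?_) (fun hab => d.compat i _ _ fun l => ?_)
    · by_cases hl : l = k
      · subst hl; simpa using hab
      · simpa [hl] using c.equiv.refl _
    · by_cases hl : l = k
      · subst hl; simpa using hab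
      · simpa [hl] using d.equiv.refl _
  let e : A.Congruence :=
    { rel := ReflTransGen r
      equiv := ⟨fun _ => .refl, fun h => ReflTransGen.mono
        (fun _ _ h => h.imp c.equiv.symm d.equiv.symm) _ _ h.swap, fun h h' => h.trans h'⟩
      compat := by
        intro i x y hxy
        -- The arguments are changed one at a time.
        have key : ∀ s : Finset (Fin (A.arity i)),
            ReflTransGen r (A.op i x) (A.op i (s.piecewise y x)) := by
          intro s
          induction s using Finset.induction_on with
          | empty => rw [Finset.piecewise_empty]
          | insert k s hk ih =>
            rw [Finset.piecewise_insert]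
            refine ih.trans ?_
            have : ReflTransGen r (A.op i (Function.update (s.piecewise y x) k (x k)))
                (A.op i (Function.update (s.piecewise y x) k (y k))) := ReflTransGen.lift
              (fun a => A.op i (Function.update (s.piecewise y x) k a))
              (fun a b hab => hop i k (s.piecewise y x) hab) _ _ (hxy k)
            rwa [← Finset.piecewise_eq_of_notMem s y x hk, Function.update_eq_self] at this
        simpa using key Finset.univ }
  have hce : c ⊔ d ≤ e := sup_le (fun _ _ h => .single (Or.inl h)) (fun _ _ h => .single (Or.inr h))
  exact hce x y h

/-- The finitely generated congruence `Θ(x, y)`. -/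
def concPrincipal (x y : L) : A.Conc := ⟨A.principal x y, {(x, y)}, by simp⟩

variable {A} in
theorem concPrincipal_le {x y : L} {c : A.Conc} : A.concPrincipal x y ≤ c ↔ c.1.rel x y :=
  principal_le

variable {A} in
theorem Conc.rel_mono {c d : A.Conc} (h : c ≤ d) {x y : L} (hxy : c.1.rel x y) : d.1.rel x y :=
  h x y hxy

theorem Conc.exists_eq_sup (c : A.Conc) :
    ∃ s : Finset (L × L), c = s.sup fun p => A.concPrincipal p.1 p.2 := by
  classical
  obtain ⟨c, s, hc⟩ := c
  refine ⟨s, Subtype.ext (hc.trans ?_)⟩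
  clear hc
  induction s using Finset.induction_on with
  | empty => rfl
  | insert p s hp ih =>
    rw [Finset.sup_insert, Finset.sup_insert, ih]
    rfl

end Operations

section Join

variable {L : Type v} [SemilatticeSup L] {ι : Type u}

/-- The join `e ∨ ⋁_{ξ ∈ s} f ξ`. -/
noncomputable def joinFrom (e : L) (f : ι → L) (s : Finset ι) : L := s.fold (· ⊔ ·) e f

variable {e : L} {f : ι → L} {s t : Finset ι}

theorem joinFrom_le {c : L} : joinFrom e f s ≤ c ↔ e ≤ c ∧ ∀ ξ ∈ s, f ξ ≤ c := by
  classical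
  unfold joinFrom
  induction s using Finset.induction_on with
  | empty => simp
  | insert a s ha ih =>
    rw [Finset.fold_insert ha, sup_le_iff, ih, Finset.forall_mem_insert]
    tauto

theorem le_joinFrom_left : e ≤ joinFrom e f s := (joinFrom_le.1 le_rfl).1

theorem le_joinFrom {ξ : ι} (h : ξ ∈ s) : f ξ ≤ joinFrom e f s := (joinFrom_le.1 le_rfl).2 ξ h

theorem joinFrom_union [DecidableEq ι] :
    joinFrom e f (s ∪ t) = joinFrom e f s ⊔ joinFrom e f t := by
  refine eq_of_forall_ge_iff fun c => ?_
  simp only [joinFrom_le, sup_le_iff, Finset.mem_union]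
  grind

theorem joinFrom_rel {A : Operations.{v, w} L} (hL : A.CongruenceCompatible (fun x y => x ⊔ y))
    {c : A.Congruence} {g : ι → L} (h : ∀ ξ ∈ s, c.rel (f ξ) (g ξ)) :
    c.rel (joinFrom e f s) (joinFrom e g s) := by
  classical
  unfold joinFrom
  induction s using Finset.induction_on with
  | empty => exact c.equiv.refl e
  | insert a s ha ih =>
    rw [Finset.forall_mem_insert] at h
    rw [Finset.fold_insert ha, Finset.fold_insert ha]
    exact hL c _ _ _ _ h.1 (ih h.2)

end Join

/-! ### Erosion -/

namespace Operations

variable {L : Type v} {A : Operations.{v, w} L} [SemilatticeSup L]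

/-- If `e` is congruent to the largest element modulo the join of two congruences, this is witnessed
by a sequence from `e` to the largest element whose steps belong alternately to the two congruences.
In the proof the sequence is kept increasing, so that a step modulo `φ j` can be appended after waiting
for an index of parity `j`. -/
theorem exists_chain [OrderTop L] (hL : A.CongruenceCompatible (fun x y => x ⊔ y))
    {φ : Bool → A.Conc} {e : L} (h : (φ false ⊔ φ true).1.rel e ⊤) :
    ∃ z : ℕ → L, z 0 = e ∧ (∀ i, (φ i.bodd).1.rel (z i) (z (i + 1))) ∧ ∃ n, z n = ⊤ := by
  have key : ∀ x, Relation.ReflTransGen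
      (fun x y => (φ false).1.rel x y ∨ (φ true).1.rel x y) e x →
      ∃ z : ℕ → L, Monotone z ∧ z 0 = e ∧ (∀ i, (φ i.bodd).1.rel (z i) (z (i + 1))) ∧
        ∃ n, x ≤ z n := by
    intro x hx
    induction hx with
    | refl => exact ⟨fun _ => e, monotone_const, rfl, fun _ => (φ _).1.equiv.refl e, 0, le_rfl⟩
    | @tail b c _ hbc ih =>
      obtain ⟨z, hz, hz0, hzr, n, hn⟩ := ih
      obtain ⟨j, hj⟩ : ∃ j, (φ j).1.rel b c := hbc.elim (fun h => ⟨_, h⟩) (fun h => ⟨_, h⟩)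
      -- The sequence may have to idle for one step, until the parity is right.
      obtain ⟨m, hnm, hm⟩ : ∃ m, n ≤ m ∧ m.bodd = j := by
        by_cases hnj : n.bodd = j
        · exact ⟨n, le_rfl, hnj⟩
        · refine ⟨n + 1, n.le_succ, ?_⟩
          rw [Nat.bodd_succ]
          cases j <;> simpa using hnj
      have hrel : (φ m.bodd).1.rel (z m) (z m ⊔ c) := by
        have := hL (φ j).1 (z m) (z m) b c ((φ j).1.equiv.refl _) hj
        rw [hm]
        simpa [sup_eq_left.2 (hn.trans (hz hnm))] using this
      refine ⟨fun i => if i ≤ m then z i else z m ⊔ c, monotone_nat_of_le_succ fun i => ?_,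
        by simpa using hz0, fun i => ?_, m + 1, by simp⟩
      · rcases lt_trichotomy i m with hi | rfl | hi
        · simpa [hi.le, Nat.succ_le_of_lt hi] using hz i.le_succ
        · simp
        · simp [hi.not_ge, (hi.trans i.lt_succ_self).not_ge]
      · rcases lt_trichotomy i m with hi | rfl | hi
        · simpa [hi.le, Nat.succ_le_of_lt hi] using hzr i
        · simpa using hrel
        · simpa [hi.not_ge, (hi.trans i.lt_succ_self).not_ge] using (φ _).1.equiv.refl _
  obtain ⟨z, _, hz0, hzr, n, hn⟩ := key ⊤ (reflTransGen_of_sup_rel A h)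
  exact ⟨z, hz0, hzr, n, top_le_iff.1 hn⟩

/-- The congruence generated by those steps of the chain `z₀ ∨ x, …, z_N ∨ x` whose number has
parity `j`. -/
def erosion (A : Operations.{v, w} L) (z : ℕ → L) (N : ℕ) (x : L) (j : Bool) : A.Conc :=
  ((Finset.range N).filter fun i => i.bodd = j).sup
    fun i => A.concPrincipal (z i ⊔ x) (z (i + 1) ⊔ x)

theorem erosion_le (hL : A.CongruenceCompatible (fun x y => x ⊔ y)) {z : ℕ → L} {N : ℕ} {x : L}
    {j : Bool} {c : A.Conc} (h : ∀ i, i.bodd = j → c.1.rel (z i) (z (i + 1))) :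
    A.erosion z N x j ≤ c :=
  Finset.sup_le fun i hi => concPrincipal_le.2
    (hL _ _ _ _ _ (h i (Finset.mem_filter.1 hi).2) (c.1.equiv.refl x))

theorem erosion_le_concPrincipal_top [OrderTop L]
    (hL : A.CongruenceCompatible (fun x y => x ⊔ y)) {z : ℕ → L} {N : ℕ} {x : L} {j : Bool} :
    A.erosion z N x j ≤ A.concPrincipal x ⊤ := by
  have key : ∀ w, (A.concPrincipal x ⊤).1.rel (w ⊔ x) ⊤ := fun w => by
    simpa using hL (A.concPrincipal x ⊤).1 w w x ⊤ ((A.concPrincipal x ⊤).1.equiv.refl w)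
      (A.principal_rel x ⊤)
  exact Finset.sup_le fun i _ => concPrincipal_le.2
    ((A.concPrincipal x ⊤).1.equiv.trans (key _) ((A.concPrincipal x ⊤).1.equiv.symm (key _)))

/-- The Erosion Lemma: in the chain `zᵢ ∨ x₀ ∨ x₁` from `x₀ ∨ x₁` to the largest element, the even
steps are identified using `x₀` alone, and the odd steps using `x₁` alone. -/
theorem concPrincipal_le_erosion_sup [OrderTop L]
    (hL : A.CongruenceCompatible (fun x y => x ⊔ y)) {z : ℕ → L} {N : ℕ} (hN : z N = ⊤)
    {x₀ x₁ : L} (h0 : z 0 ≤ x₀ ⊔ x₁) :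
    A.concPrincipal (x₀ ⊔ x₁) ⊤ ≤ A.erosion z N x₀ false ⊔ A.erosion z N x₁ true := by
  set c := A.erosion z N x₀ false ⊔ A.erosion z N x₁ true
  have step : ∀ i < N, c.1.rel (z i ⊔ (x₀ ⊔ x₁)) (z (i + 1) ⊔ (x₀ ⊔ x₁)) := by
    intro i hi
    have mem : i ∈ (Finset.range N).filter fun k => k.bodd = i.bodd :=
      Finset.mem_filter.2 ⟨Finset.mem_range.2 hi, rfl⟩
    cases hb : i.bodd
    · rw [hb] at mem
      have h1 : A.concPrincipal (z i ⊔ x₀) (z (i + 1) ⊔ x₀) ≤ c :=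
        (Finset.le_sup (f := fun i => A.concPrincipal (z i ⊔ x₀) (z (i + 1) ⊔ x₀)) mem).trans
          le_sup_left
      simpa [sup_assoc] using hL c.1 _ _ x₁ x₁ (concPrincipal_le.1 h1) (c.1.equiv.refl x₁)
    · rw [hb] at mem
      have h1 : A.concPrincipal (z i ⊔ x₁) (z (i + 1) ⊔ x₁) ≤ c :=
        (Finset.le_sup (f := fun i => A.concPrincipal (z i ⊔ x₁) (z (i + 1) ⊔ x₁)) mem).trans
          le_sup_right
      simpa [sup_assoc, sup_comm x₁ x₀] using
        hL c.1 _ _ x₀ x₀ (concPrincipal_le.1 h1) (c.1.equiv.refl x₀)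
  have chain : ∀ i ≤ N, c.1.rel (x₀ ⊔ x₁) (z i ⊔ (x₀ ⊔ x₁)) := by
    intro i
    induction i with
    | zero =>
      intro _
      rw [sup_eq_right.2 h0]
      exact c.1.equiv.refl _
    | succ i ih => exact fun hi => c.1.equiv.trans (ih (by omega)) (step i (by omega))
  refine concPrincipal_le.2 ?_
  simpa [hN] using chain N le_rfl

end Operations

/-! ### Killing the congruences that reach the largest element -/

open FreeDistrib GenSemilattice in
/-- Every principal congruence `Θ(e, 1)` contained in a congruence with image `1` has image `0`. -/
theorem map_concPrincipal_top_eq_bot {Ω : Type u}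
    (hΩ : Cardinal.aleph (Ordinal.omega0 + 1) ≤ Cardinal.mk Ω)
    {L : Type v} {A : Operations.{v, w} L} [SemilatticeSup L] [OrderTop L]
    (hL : A.CongruenceCompatible (fun x y => x ⊔ y)) {μ : SupBotHom A.Conc (GSemilattice Ω)}
    (hμ : WeaklyDistributive μ) {c : A.Conc} (hc : μ c = ⊤) {e : L} (he : c.1.rel e ⊤) :
    μ (A.concPrincipal e ⊤) = ⊥ := by
  classical
  have hφ : ∀ ξ : Ω, ∃ φ : Bool → A.Conc, (∀ j, μ (φ j) ≤ ofBase _ (gen ξ j)) ∧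
      c ≤ φ false ⊔ φ true := fun ξ => by
    obtain ⟨φ₀, φ₁, h, h₀, h₁⟩ := hμ c (ofBase _ (gen ξ false)) (ofBase _ (gen ξ true))
      (by rw [hc, GSemilattice.ofBase_gen_sup])
    exact ⟨fun j => cond j φ₁ φ₀, fun j => by cases j <;> assumption, h⟩
  choose φ hφle hφc using hφ
  have hchain := fun ξ => Operations.exists_chain hL
    (Operations.Conc.rel_mono (hφc ξ) he)
  choose z hz0 hzr n hn using hchain
  obtain ⟨N, hN⟩ := exists_large_fiber hΩ n fun N => 2 ^ N
  choose W hW using GSemilattice.exists_supportedBy (Ω := Ω)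
  let J (i : ℕ) (B : Finset Ω) : L := joinFrom e (fun ξ => z ξ i) B
  let supp (B : Finset Ω) (i : ℕ) : Finset Ω := W (μ (A.concPrincipal (J i B) ⊤))
  let suppErosion (δ : Ω) (B : Finset Ω) (i : ℕ) (j : Bool) : Finset Ω :=
    W (μ (A.erosion (z δ) N (J i B) j))
  -- `Φ F` contains the supports of all congruences built below from chains with indices in `F`.
  obtain ⟨H, hHX, hHcard, hfree⟩ := exists_free_finset (2 ^ N) _ hN fun F =>
    F.powerset.biUnion fun B => (Finset.range N).biUnion fun i =>
      supp B i ∪ F.biUnion fun δ => Finset.univ.biUnion fun j => suppErosion δ B i j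
  have hfree₁ : ∀ B ⊆ H, ∀ i < N, ∀ h ∈ H, h ∉ B → h ∉ supp B i := by
    intro B hB i hi h hh hhB hmem
    refine hfree B hB h hh hhB (Finset.mem_biUnion.2 ⟨B, Finset.mem_powerset_self B,
      Finset.mem_biUnion.2 ⟨i, Finset.mem_range.2 hi, Finset.mem_union_left _ hmem⟩⟩)
  have hfree₂ : ∀ B ⊆ H, ∀ δ ∈ H, ∀ i < N, ∀ j, ∀ B' ⊆ H, δ ∉ B' → Disjoint B B' →
      Disjoint (suppErosion δ B i j) B' := by
    intro B hB δ hδ i hi j B' hB' hδB' hBB'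
    refine Finset.disjoint_right.2 fun h hh hmem => ?_
    refine hfree (insert δ B) (Finset.insert_subset hδ hB) h (hB' hh) ?_
      (Finset.mem_biUnion.2 ⟨B, Finset.mem_powerset.2 (Finset.subset_insert δ B),
        Finset.mem_biUnion.2 ⟨i, Finset.mem_range.2 hi, Finset.mem_union_right _
          (Finset.mem_biUnion.2 ⟨δ, Finset.mem_insert_self δ B,
            Finset.mem_biUnion.2 ⟨j, Finset.mem_univ j, hmem⟩⟩)⟩⟩)
    rw [Finset.mem_insert, not_or]
    exact ⟨fun h' => hδB' (h' ▸ hh), Finset.disjoint_right.1 hBB' hh⟩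
  have hzN : ∀ ξ ∈ H, z ξ N = ⊤ := fun ξ hξ => by
    have hξN : n ξ = N := hHX hξ
    rw [← hξN]
    exact hn ξ
  -- Going down the chains, twice as many of them are needed at each step.
  have descend : ∀ k ≤ N, ∀ B ⊆ H, B.card = 2 ^ k → μ (A.concPrincipal (J (N - k) B) ⊤) = ⊥ := by
    intro k
    induction k with
    | zero =>
      intro _ B hB hcard
      obtain ⟨ξ, hξ⟩ : B.Nonempty := Finset.card_pos.1 (by rw [hcard]; simp)
      have hJ : J N B = ⊤ := top_le_iff.1 ((hzN ξ (hB hξ)).ge.trans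
        (le_joinFrom (f := fun ξ => z ξ N) hξ))
      rw [Nat.sub_zero, hJ, ← map_bot μ]
      refine congrArg μ (le_bot_iff.1 (Operations.concPrincipal_le.2 ?_))
      exact (⊥ : A.Conc).1.equiv.refl _
    | succ k ih =>
      intro hk B hB hcard
      obtain ⟨i, hi⟩ : ∃ i, i = N - (k + 1) := ⟨_, rfl⟩
      rw [← hi]
      have hiN : i < N := by omega
      rw [show N - k = i + 1 by omega] at ih
      obtain ⟨B₀, hB₀, hcard₀⟩ := Finset.exists_subset_card_eq (s := B) (n := 2 ^ k)
        (by rw [hcard]; exact Nat.pow_le_pow_right two_pos k.le_succ)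
      have hcard₁ : (B \ B₀).card = 2 ^ k := by
        rw [Finset.card_sdiff_of_subset hB₀, hcard, hcard₀, pow_succ]
        omega
      have hB₁ : B \ B₀ ⊆ B := Finset.sdiff_subset
      obtain ⟨δ, hδH, hδB⟩ : ∃ δ ∈ H, δ ∉ B := by
        refine Finset.exists_mem_notMem_of_card_lt_card ?_
        rw [hcard, hHcard]
        exact Nat.lt_succ_of_le (Nat.pow_le_pow_right two_pos hk)
      have hside : ∀ B' ⊆ H, B'.card = 2 ^ k →
          μ (A.concPrincipal (J i B') ⊤) ≤ ofBase _ (genSup i.bodd B') := by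
        intro B' hB' hcard'
        have hle : A.concPrincipal (J i B') ⊤ ≤
            A.concPrincipal (J (i + 1) B') ⊤ ⊔ B'.sup fun ξ => φ ξ i.bodd := by
          refine Operations.concPrincipal_le.2 (Operations.Congruence.equiv _ |>.trans
            (Operations.Conc.rel_mono le_sup_right (joinFrom_rel (g := fun ξ => z ξ (i + 1)) hL
              fun ξ hξ => ?_))
            (Operations.Conc.rel_mono le_sup_left (A.principal_rel _ _)))
          exact Operations.Conc.rel_mono (Finset.le_sup (f := fun ξ => φ ξ i.bodd) hξ) (hzr ξ i)
        refine (OrderHomClass.mono μ hle).trans ?_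
        rw [map_sup, ih (by omega) B' hB' hcard', map_finset_sup]
        refine sup_le bot_le (Finset.sup_le fun ξ hξ => (hφle ξ _).trans ?_)
        rw [ofBase_le_ofBase, ← genSup_singleton]
        exact genSup_mono (Finset.singleton_subset_iff.2 hξ)
      have hJ : J i B = J i B₀ ⊔ J i (B \ B₀) := by
        rw [← joinFrom_union, Finset.union_sdiff_of_subset hB₀]
      have herode := Operations.concPrincipal_le_erosion_sup hL (hzN δ hδH) (x₀ := J i B₀)
        (x₁ := J i (B \ B₀)) (by rw [hz0]; exact le_joinFrom_left.trans le_sup_left)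
      rw [← hJ] at herode
      have hparity : ∀ x j, μ (A.erosion (z δ) N x j) ≤ ofBase _ (gen δ j) := fun x j =>
        (OrderHomClass.mono μ (Operations.erosion_le hL fun i hi => hi ▸ hzr δ i)).trans (hφle δ j)
      have htop : ∀ B' ⊆ H, B'.card = 2 ^ k → ∀ j,
          μ (A.erosion (z δ) N (J i B') j) ≤ ofBase _ (genSup i.bodd B') := fun B' h h' j =>
        (OrderHomClass.mono μ (Operations.erosion_le_concPrincipal_top hL)).trans (hside B' h h')
      refine GSemilattice.evaporation (δ := δ) (A₀ := B₀) (A₁ := B \ B₀)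
        (fun h => hδB (hB₀ h)) (fun h => hδB (hB₁ h))
        (hfree₂ B₀ (hB₀.trans hB) δ hδH i hiN false _ (hB₁.trans hB) (fun h => hδB (hB₁ h))
          Finset.disjoint_sdiff)
        (hfree₂ _ (hB₁.trans hB) δ hδH i hiN true B₀ (hB₀.trans hB) (fun h => hδB (hB₀ h))
          Finset.sdiff_disjoint)
        (hfree₁ B hB i hiN δ hδH hδB) (hW _) (hW _) (hW _)
        (hparity _ _) (htop B₀ (hB₀.trans hB) hcard₀ _) (hparity _ _)
        (htop _ (hB₁.trans hB) hcard₁ _) ?_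
      rw [← map_sup]
      exact OrderHomClass.mono μ herode
  obtain ⟨B, hB, hcard⟩ := Finset.exists_subset_card_eq (s := H) (n := 2 ^ N) (by omega)
  have hJ : J 0 B = e :=
    le_antisymm (joinFrom_le.2 ⟨le_rfl, fun ξ _ => (hz0 ξ).le⟩) le_joinFrom_left
  simpa [hJ] using descend N le_rfl B hB hcard

theorem theorem6p1 {Ω : Type u} (hΩ : Cardinal.aleph (Ordinal.omega0 + 1) ≤ Cardinal.mk Ω)
    {L : Type v} (A : Operations.{v, w} L) [SemilatticeSup L] [OrderTop L]
    (hL : A.CongruenceCompatible (fun x y => x ⊔ y)) :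
    ¬ ∃ μ : SupBotHom A.Conc (GSemilattice Ω),
      WeaklyDistributive μ ∧ (⊤ : GSemilattice Ω) ∈ Set.range μ := by
  rintro ⟨μ, hμ, c, hc⟩
  obtain ⟨s, rfl⟩ := Operations.Conc.exists_eq_sup A c
  let d : A.Conc := s.sup fun p => A.concPrincipal p.1 ⊤ ⊔ A.concPrincipal p.2 ⊤
  have hpd : ∀ p ∈ s, A.concPrincipal p.1 ⊤ ⊔ A.concPrincipal p.2 ⊤ ≤ d := fun p hp =>
    Finset.le_sup (f := fun p : L × L => A.concPrincipal p.1 ⊤ ⊔ A.concPrincipal p.2 ⊤) hp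
  have hrel : ∀ p ∈ s, d.1.rel p.1 ⊤ ∧ d.1.rel p.2 ⊤ := fun p hp =>
    ⟨Operations.concPrincipal_le.1 (le_sup_left.trans (hpd p hp)),
      Operations.concPrincipal_le.1 (le_sup_right.trans (hpd p hp))⟩
  have hd : μ d = ⊤ := by
    refine top_le_iff.1 (hc.ge.trans (OrderHomClass.mono μ (Finset.sup_le fun p hp => ?_)))
    exact Operations.concPrincipal_le.2
      (d.1.equiv.trans (hrel p hp).1 (d.1.equiv.symm (hrel p hp).2))
  refine GSemilattice.bot_ne_top (Ω := Ω) (le_antisymm bot_le (hd.ge.trans ?_))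
  rw [map_finset_sup]
  refine Finset.sup_le fun p hp => ?_
  simp only [Function.comp_apply, map_sup]
  rw [map_concPrincipal_top_eq_bot hΩ hL hμ hd (hrel p hp).1,
    map_concPrincipal_top_eq_bot hΩ hL hμ hd (hrel p hp).2, sup_idem]
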